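/- Let $p,q\ge 1$ be integers and let $a=(a_1,\dots,a_p)$, $b=(b_1,\dots,b_q)$ have positive components with $\sum_i a_i=\sum_j b_j=1$. For $I\subset\{1,\dots,p\}$ and $J\subset\{1,\dots,q\}$ write $a(I)=\sum_{i\in I}a_i$, $b(J)=\sum_{j\in J}b_j$ (and similarly for other vectors). For a real $p\times q$ matrix $X$ put $R_i(X)=\frac1{a_i}\sum_j X(i,j)$ and $C_j(X)=\frac1{b_j}\sum_i X(i,j)$. Let $\Gamma_0$ be the set of $p\times q$ matrices with non-negative entries all of whose row sums and column sums are positive. Let $X_0\in\Gamma_0$, and define the iterative proportional fitting sequence $(X_n)_{n\ge0}$ by $X_{n+1}(i,j)=R_i(X_n)^{-1}X_n(i,j)$ if $n$ is even and $X_{n+1}(i,j)=C_j(X_n)^{-1}X_n(i,j)$ if $n$ is odd. Write $\mathrm{Supp}(X)=\{(i,j):X(i,j)>0\}$, and for vectors $\alpha\in\mathbf R^p$, $\beta\in\mathbf R^q$ let $\Gamma(\alpha,\beta,X_0)$ be the set of matrices $S\in\Gamma_0$ with row sums $\alpha_i$, column sums $\beta_j$ and $\mathrm{Supp}(S)\subset\mathrm{Supp}(X_0)$.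 Let $D(Y\|X_0)=\sum_{(i,j)\in\mathrm{Supp}(X_0)}Y(i,j)\ln\frac{Y(i,j)}{X_0(i,j)}$ if $\mathrm{Supp}(Y)\subset\mathrm{Supp}(X_0)$ (with $0\ln0=0$), and $D(Y\|X_0)=+\infty$ otherwise. A sequence $x_n\to\ell$ is said to converge at a geometric rate if $\lim_n\|x_n-\ell\|^{1/n}$ exists and lies in $(0,1)$. Then (whether $\Gamma(a,b,X_0)$ is empty or not) there exist a positive integer $r\le\min(p,q)$ and partitions $\{I_1,\dots,I_r\}$ of $\{1,\dots,p\}$ and $\{J_1,\dots,J_r\}$ of $\{1,\dots,q\}$ into non-empty blocks such that, with $\lambda_k=b(J_k)/a(I_k)$, $a'_i=\lambda_k a_i$ for $i\in I_k$ and $b'_j=\lambda_k^{-1}b_j$ for $j\in J_k$: 1. $R_i(X_{2n})\to\lambda_k$ as $n\to\infty$ whenever $i\in I_k$; 2. $C_j(X_{2n+1})\to\lambda_k^{-1}$ as $n\to\infty$ whenever $j\in J_k$; 3. $X_n(i,j)=0$ for every $n\ge0$ whenever $i\in I_k$ and $j\in J_{k'}$ with $k<k'$; 4. whenever $i\in I_k$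 and $j\in J_{k'}$ with $k>k'$: if $X_0(i,j)>0$ then $X_n(i,j)\to0$ at a geometric rate, and if $X_0(i,j)=0$ then $X_n(i,j)=0$ for every $n\ge0$; 5. $(X_{2n})_{n\ge0}$ converges to the unique matrix achieving the minimum of $D(Y\|X_0)$ over all $Y\in\Gamma(a',b,X_0)$; 6. $(X_{2n+1})_{n\ge0}$ converges to the unique matrix achieving the minimum of $D(Y\|X_0)$ over all $Y\in\Gamma(a,b',X_0)$; 7. for every $k$, $a'(I_k)=b(J_k)$ and $a(I_k)=b'(J_k)$; moreover the support of any matrix in $\Gamma(a',b,X_0)\cup\Gamma(a,b',X_0)$ is contained in $I_1\times J_1\cup\dots\cup I_r\times J_r$; 8. with $D_1=\mathrm{Diag}(a'_1/a_1,\dots,a'_p/a_p)$ and $D_2=\mathrm{Diag}(b_1/b'_1,\dots,b_q/b'_q)$, every $S\in\Gamma(a,b',X_0)$ satisfies $D_1S=SD_2\in\Gamma(a',b,X_0)$, and every matrix in $\Gamma(a',b,X_0)$ is of the form $D_1S$ with $S\in\Gamma(a,b',X_0)$. -/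

import Mathlib

open Filter Topology

namespace IPFP

noncomputable section

variable {p q : ℕ}

/-- `R_i(X) = X(i,+) / a_i`, the normalised sum of row `i`. -/
def rowRatio (a : Fin p → ℝ) (X : Matrix (Fin p) (Fin q) ℝ) (i : Fin p) : ℝ :=
  (∑ j, X i j) / a i

/-- `C_j(X) = X(+,j) / b_j`, the normalised sum of column `j`. -/
def colRatio (b : Fin q → ℝ) (X : Matrix (Fin p) (Fin q) ℝ) (j : Fin q) : ℝ :=
  (∑ i, X i j) / b j

/-- Non-negative matrices all of whose row sums and column sums are positive. -/
def Gamma0 (p q : ℕ) : Set (Matrix (Fin p) (Fin q) ℝ) :=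
  {X | (∀ i j, 0 ≤ X i j) ∧ (∀ i, 0 < ∑ j, X i j) ∧ (∀ j, 0 < ∑ i, X i j)}

/-- The row scaling `T_R(X)(i,j) = R_i(X)⁻¹ X(i,j)`. -/
def scaleRows (a : Fin p → ℝ) (X : Matrix (Fin p) (Fin q) ℝ) : Matrix (Fin p) (Fin q) ℝ :=
  Matrix.of fun i j => (rowRatio a X i)⁻¹ * X i j

/-- The column scaling `T_C(X)(i,j) = C_j(X)⁻¹ X(i,j)`. -/
def scaleCols (b : Fin q → ℝ) (X : Matrix (Fin p) (Fin q) ℝ) : Matrix (Fin p) (Fin q) ℝ :=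
  Matrix.of fun i j => (colRatio b X j)⁻¹ * X i j

/-- The sequence `X_0, X_1 = T_R(X_0), X_2 = T_C(X_1), X_3 = T_R(X_2), …`. -/
def ipfp (a : Fin p → ℝ) (b : Fin q → ℝ) (X₀ : Matrix (Fin p) (Fin q) ℝ) :
    ℕ → Matrix (Fin p) (Fin q) ℝ
  | 0 => X₀
  | n + 1 => if Even n then scaleRows a (ipfp a b X₀ n) else scaleCols b (ipfp a b X₀ n)

/-- The set of positions of the positive entries of `X`. -/
def supp (X : Matrix (Fin p) (Fin q) ℝ) : Set (Fin p × Fin q) :=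
  {x | 0 < X x.1 x.2}

/-- `Γ(a,b,X)`: the matrices of `Γ_0` with row sums `a` and column sums `b` whose support is
included in the support of `X`. -/
def Gamma (a : Fin p → ℝ) (b : Fin q → ℝ) (X : Matrix (Fin p) (Fin q) ℝ) :
    Set (Matrix (Fin p) (Fin q) ℝ) :=
  {S | S ∈ Gamma0 p q ∧ (∀ i, ∑ j, S i j = a i) ∧ (∀ j, ∑ i, S i j = b j) ∧ supp S ⊆ supp X}

open Classical in
/-- The I-divergence `D(Y‖X)`. Since `Real.log 0 = 0`, terms with `Y(i,j) = 0` vanish. -/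
def iDiv (Y X : Matrix (Fin p) (Fin q) ℝ) : EReal :=
  if supp Y ⊆ supp X then
    ((∑ x : Fin p × Fin q with x ∈ supp X,
      Y x.1 x.2 * Real.log (Y x.1 x.2 / X x.1 x.2) : ℝ) : EReal)
  else ⊤

/-- `L` is the unique matrix achieving the minimum of `D(Y‖X)` over all `Y ∈ E`. -/
def IsIProjection (X : Matrix (Fin p) (Fin q) ℝ) (E : Set (Matrix (Fin p) (Fin q) ℝ))
    (L : Matrix (Fin p) (Fin q) ℝ) : Prop :=
  L ∈ E ∧ (∀ Y ∈ E, iDiv L X ≤ iDiv Y X) ∧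
    ∀ L' ∈ E, (∀ Y ∈ E, iDiv L' X ≤ iDiv Y X) → L' = L

/-- `I_1, …, I_r` are the (non-empty, pairwise disjoint) blocks of a partition of `α`. -/
def IsPartition {r : ℕ} {α : Type*} (I : Fin r → Finset α) : Prop :=
  (∀ k, (I k).Nonempty) ∧ (∀ k l, k ≠ l → Disjoint (I k) (I l)) ∧ ∀ x, ∃ k, x ∈ I k

/-- `x_n → l` at a geometric rate: `lim ‖x_n - l‖ ^ (1/n)` exists and lies in `(0,1)`. -/
def ConvergesGeometrically {E : Type*} [NormedAddCommGroup E] (x : ℕ → E) (l : E) : Prop :=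
  Tendsto x atTop (𝓝 l) ∧
    ∃ ρ : ℝ, 0 < ρ ∧ ρ < 1 ∧
      Tendsto (fun n : ℕ => ‖x n - l‖ ^ (1 / (n : ℝ))) atTop (𝓝 ρ)

end

end IPFP

/-!
The two scalings are alternating minimisations of the relative entropy `D(P‖Q)`, for `P` with row
sums `a` and `Q` with column sums `b`: each scaling is an I-projection in either argument. This
yields convergence in the manner of Csiszár and Tusnády. Write `Q n` for the even iterates, `P n`
for the odd ones. The quantity `∑ a_i log R_i(Q n) = -D(P n‖Q n)` is nondecreasing
(`rowPotential_mono`). Let `L` be a limit point of `Q n`; its row sums are positive because a sweep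
keeps them away from `0`. The five-point inequality, applied to the limit point `scaleRows a L`
itself, shows that `D(scaleRows a L‖P n)` is nonincreasing (`relEnt_step_le`); it tends to `0`
along a subsequence, hence altogether, and a Hellinger lower bound turns this into convergence
(`exists_tendsto_sweep`). No assumption on the existence of a matrix with marginals `a` and `b`
enters.

Let `ρ_i` and `γ_j` be the limits of the row and column ratios. Since a full sweep fixes `L`,
`ρ_i γ_j = 1` wherever `L(i,j) ≠ 0`. The blocks are the level sets of `ρ` and of `1/γ`, in
increasing order of the value. On the support of `X₀`, a Cesàro argument gives
`log X_n(i,j) / n → -log(ρ_i γ_j) / 2`; boundedness then excludes `ρ_i γ_j < 1` (null blocks),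
and `ρ_i γ_j > 1` means geometric decay. For `S` with the marginals of `L`, the sum
`∑ S(i,j) log(ρ_i γ_j)` depends only on the marginals, so it vanishes; its terms are nonnegative,
which confines `S` to the diagonal blocks (`IsEvenLimit.eq_one_of_pos`).

Finally every iterate is `u_i v_j X₀(i,j)`, so `D(Y‖X₀) - D(Y‖X_n)` depends only on the marginals of
`Y`. Comparing with the limit gives `D(Y‖X₀) - D(L‖X₀) ≥ ∑ (√Y - √L)²`, which is both minimality
and uniqueness (`isIProjection_of_tendsto_scaling`).
-/

namespace IPFP

variable {p q : ℕ} {a : Fin p → ℝ} {b : Fin q → ℝ}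

/-! ### The two scalings -/

theorem scaleRows_apply (a : Fin p → ℝ) (X : Matrix (Fin p) (Fin q) ℝ) (i : Fin p) (j : Fin q) :
    scaleRows a X i j = (rowRatio a X i)⁻¹ * X i j := rfl

theorem scaleCols_apply (b : Fin q → ℝ) (X : Matrix (Fin p) (Fin q) ℝ) (i : Fin p) (j : Fin q) :
    scaleCols b X i j = (colRatio b X j)⁻¹ * X i j := rfl

theorem transpose_mem_Gamma0 {X : Matrix (Fin p) (Fin q) ℝ} (hX : X ∈ Gamma0 p q) :
    X.transpose ∈ Gamma0 q p :=
  ⟨fun j i => hX.1 i j, hX.2.2, hX.2.1⟩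

theorem rowRatio_pos (ha : ∀ i, 0 < a i) {X : Matrix (Fin p) (Fin q) ℝ} (hX : X ∈ Gamma0 p q)
    (i : Fin p) : 0 < rowRatio a X i :=
  div_pos (hX.2.1 i) (ha i)

theorem colRatio_pos (hb : ∀ j, 0 < b j) {X : Matrix (Fin p) (Fin q) ℝ} (hX : X ∈ Gamma0 p q)
    (j : Fin q) : 0 < colRatio b X j :=
  div_pos (hX.2.2 j) (hb j)

theorem sum_row_eq (ha : ∀ i, 0 < a i) (X : Matrix (Fin p) (Fin q) ℝ) (i : Fin p) :
    ∑ j, X i j = rowRatio a X i * a i :=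
  (div_mul_cancel₀ _ (ha i).ne').symm

theorem sum_col_eq (hb : ∀ j, 0 < b j) (X : Matrix (Fin p) (Fin q) ℝ) (j : Fin q) :
    ∑ i, X i j = colRatio b X j * b j :=
  (div_mul_cancel₀ _ (hb j).ne').symm

theorem scaleRows_sum_row (ha : ∀ i, 0 < a i) {X : Matrix (Fin p) (Fin q) ℝ}
    (hX : X ∈ Gamma0 p q) (i : Fin p) : ∑ j, scaleRows a X i j = a i := by
  simp only [scaleRows_apply, ← Finset.mul_sum]
  rw [sum_row_eq ha, inv_mul_cancel_left₀ (rowRatio_pos ha hX i).ne']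

theorem scaleCols_sum_col (hb : ∀ j, 0 < b j) {X : Matrix (Fin p) (Fin q) ℝ}
    (hX : X ∈ Gamma0 p q) (j : Fin q) : ∑ i, scaleCols b X i j = b j :=
  scaleRows_sum_row hb (transpose_mem_Gamma0 hX) j

theorem scaleRows_mem_Gamma0 (ha : ∀ i, 0 < a i) {X : Matrix (Fin p) (Fin q) ℝ}
    (hX : X ∈ Gamma0 p q) : scaleRows a X ∈ Gamma0 p q := by
  have hpos := rowRatio_pos ha hX
  refine ⟨fun i j => mul_nonneg (inv_nonneg.2 (hpos i).le) (hX.1 i j),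
    fun i => by rw [scaleRows_sum_row ha hX]; exact ha i, fun j => ?_⟩
  obtain ⟨i, -, hi⟩ := (Finset.sum_pos_iff_of_nonneg fun i _ => hX.1 i j).1 (hX.2.2 j)
  exact Finset.sum_pos' (fun i _ => mul_nonneg (inv_nonneg.2 (hpos i).le) (hX.1 i j))
    ⟨i, Finset.mem_univ i, mul_pos (inv_pos.2 (hpos i)) hi⟩

theorem scaleCols_mem_Gamma0 (hb : ∀ j, 0 < b j) {X : Matrix (Fin p) (Fin q) ℝ}
    (hX : X ∈ Gamma0 p q) : scaleCols b X ∈ Gamma0 p q :=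
  transpose_mem_Gamma0 (scaleRows_mem_Gamma0 hb (transpose_mem_Gamma0 hX))

theorem rowRatio_mul_scaleRows (ha : ∀ i, 0 < a i) {X : Matrix (Fin p) (Fin q) ℝ}
    (hX : X ∈ Gamma0 p q) (i : Fin p) (j : Fin q) :
    rowRatio a X i * scaleRows a X i j = X i j :=
  mul_inv_cancel_left₀ (rowRatio_pos ha hX i).ne' _

/-- Scaling the columns of a matrix of total mass `1` cannot shrink column `j` by more than the
factor `b j`, since no column sum exceeds `1`. -/
theorem mul_le_scaleCols (hb : ∀ j, 0 < b j) {X : Matrix (Fin p) (Fin q) ℝ}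
    (hX : X ∈ Gamma0 p q) (h1 : ∑ i, ∑ j, X i j = 1) (i : Fin p) (j : Fin q) :
    b j * X i j ≤ scaleCols b X i j := by
  refine mul_le_mul_of_nonneg_right ?_ (hX.1 i j)
  rw [le_inv_comm₀ (hb j) (colRatio_pos hb hX j), colRatio, div_eq_mul_inv]
  refine mul_le_of_le_one_left (inv_nonneg.2 (hb j).le) ?_
  rw [← Finset.sum_comm.trans h1]
  exact Finset.single_le_sum (f := fun j => ∑ i, X i j)
    (fun j _ => Finset.sum_nonneg fun i _ => hX.1 i j) (Finset.mem_univ j)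

theorem tendsto_rowRatio {ι : Type*} {l : Filter ι} {Z : ι → Matrix (Fin p) (Fin q) ℝ}
    {L : Matrix (Fin p) (Fin q) ℝ} (h : ∀ i j, Tendsto (fun n => Z n i j) l (𝓝 (L i j)))
    (i : Fin p) : Tendsto (fun n => rowRatio a (Z n) i) l (𝓝 (rowRatio a L i)) :=
  (tendsto_finsetSum _ fun j _ => h i j).div_const _

theorem tendsto_colRatio {ι : Type*} {l : Filter ι} {Z : ι → Matrix (Fin p) (Fin q) ℝ}
    {L : Matrix (Fin p) (Fin q) ℝ} (h : ∀ i j, Tendsto (fun n => Z n i j) l (𝓝 (L i j)))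
    (j : Fin q) : Tendsto (fun n => colRatio b (Z n) j) l (𝓝 (colRatio b L j)) :=
  (tendsto_finsetSum _ fun i _ => h i j).div_const _

theorem tendsto_scaleRows {ι : Type*} {l : Filter ι} {Z : ι → Matrix (Fin p) (Fin q) ℝ}
    {L : Matrix (Fin p) (Fin q) ℝ} (ha : ∀ i, 0 < a i) (hL : L ∈ Gamma0 p q)
    (h : ∀ i j, Tendsto (fun n => Z n i j) l (𝓝 (L i j))) (i : Fin p) (j : Fin q) :
    Tendsto (fun n => scaleRows a (Z n) i j) l (𝓝 (scaleRows a L i j)) :=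
  ((tendsto_rowRatio h i).inv₀ (rowRatio_pos ha hL i).ne').mul (h i j)

theorem tendsto_scaleCols {ι : Type*} {l : Filter ι} {Z : ι → Matrix (Fin p) (Fin q) ℝ}
    {L : Matrix (Fin p) (Fin q) ℝ} (hb : ∀ j, 0 < b j) (hL : L ∈ Gamma0 p q)
    (h : ∀ i j, Tendsto (fun n => Z n i j) l (𝓝 (L i j))) (i : Fin p) (j : Fin q) :
    Tendsto (fun n => scaleCols b (Z n) i j) l (𝓝 (scaleCols b L i j)) :=
  ((tendsto_colRatio h j).inv₀ (colRatio_pos hb hL j).ne').mul (h i j)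

/-! ### Relative entropy -/

/-- The relative entropy `∑ Y(i,j) log (Y(i,j) / Z(i,j))`, summed over all positions. When
`Z(i,j) = 0` forces `Y(i,j) = 0`, positions outside the support of `Y` contribute `0`. -/
noncomputable def relEnt (Y Z : Matrix (Fin p) (Fin q) ℝ) : ℝ :=
  ∑ i, ∑ j, Y i j * Real.log (Y i j / Z i j)

/-- Hellinger lower bound for one term of the relative entropy. -/
theorem sub_add_sq_le_mul_log {y z : ℝ} (hy : 0 ≤ y) (hz : 0 ≤ z) (h : z = 0 → y = 0) :
    y - z + (√y - √z) ^ 2 ≤ y * Real.log (y / z) := by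
  rcases hy.eq_or_lt with rfl | hy'
  · simp [Real.sq_sqrt hz]
  have hz' : 0 < z := hz.lt_of_ne fun h0 => hy'.ne' (h h0.symm)
  have hsy := Real.sqrt_pos.2 hy'
  have hsz := Real.sqrt_pos.2 hz'
  have hlog : Real.log (y / z) = -(2 * Real.log (√z / √y)) := by
    rw [Real.log_div hy'.ne' hz'.ne', Real.log_div hsz.ne' hsy.ne', Real.log_sqrt hy,
      Real.log_sqrt hz]
    ring
  have h1 := Real.log_le_sub_one_of_pos (div_pos hsz hsy)
  have h2 : y * (√z / √y) = √y * √z := by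
    nth_rewrite 1 [← Real.mul_self_sqrt hy]
    field_simp
  rw [hlog]
  nlinarith [mul_le_mul_of_nonneg_left h1 hy, Real.sq_sqrt hy, Real.sq_sqrt hz]

theorem sum_sq_sqrt_sub_le_relEnt {Y Z : Matrix (Fin p) (Fin q) ℝ} (hY : ∀ i j, 0 ≤ Y i j)
    (hZ : ∀ i j, 0 ≤ Z i j) (h0 : ∀ i j, Z i j = 0 → Y i j = 0)
    (h1 : ∑ i, ∑ j, Y i j = ∑ i, ∑ j, Z i j) :
    ∑ i, ∑ j, (√(Y i j) - √(Z i j)) ^ 2 ≤ relEnt Y Z := by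
  have h : ∑ i, ∑ j, (Y i j - Z i j + (√(Y i j) - √(Z i j)) ^ 2) ≤ relEnt Y Z :=
    Finset.sum_le_sum fun i _ => Finset.sum_le_sum fun j _ =>
      sub_add_sq_le_mul_log (hY i j) (hZ i j) (h0 i j)
  simp only [Finset.sum_add_distrib, Finset.sum_sub_distrib, h1, sub_self, zero_add] at h
  exact h

theorem tendsto_relEnt_zero {ι : Type*} {l : Filter ι} {Y : Matrix (Fin p) (Fin q) ℝ}
    {Z : ι → Matrix (Fin p) (Fin q) ℝ}
    (h : ∀ i j, Tendsto (fun n => Z n i j) l (𝓝 (Y i j))) :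
    Tendsto (fun n => relEnt Y (Z n)) l (𝓝 0) := by
  have : Tendsto (fun n => relEnt Y (Z n)) l (𝓝 (∑ _i : Fin p, ∑ _j : Fin q, (0 : ℝ))) := by
    refine tendsto_finsetSum _ fun i _ => tendsto_finsetSum _ fun j _ => ?_
    by_cases hy : Y i j = 0
    · simpa [hy] using tendsto_const_nhds
    · have h1 := (tendsto_const_nhds (x := Y i j)).div (h i j) hy
      have h2 := (h1.log (div_ne_zero hy hy)).const_mul (Y i j)
      simpa [div_self hy] using h2
  simpa using this

/-- Convergence in relative entropy implies entrywise convergence. -/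
theorem tendsto_of_relEnt {ι : Type*} {l : Filter ι} {Y : Matrix (Fin p) (Fin q) ℝ}
    {Z : ι → Matrix (Fin p) (Fin q) ℝ} (hY : ∀ i j, 0 ≤ Y i j) (hZ : ∀ n i j, 0 ≤ Z n i j)
    (h0 : ∀ n i j, Z n i j = 0 → Y i j = 0)
    (h1 : ∀ n, ∑ i, ∑ j, Y i j = ∑ i, ∑ j, Z n i j)
    (h : Tendsto (fun n => relEnt Y (Z n)) l (𝓝 0)) (i : Fin p) (j : Fin q) :
    Tendsto (fun n => Z n i j) l (𝓝 (Y i j)) := by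
  have hsq : Tendsto (fun n => (√(Y i j) - √(Z n i j)) ^ 2) l (𝓝 0) := by
    refine squeeze_zero (fun n => sq_nonneg _) (fun n => ?_) h
    refine le_trans ?_ (sum_sq_sqrt_sub_le_relEnt hY (hZ n) (h0 n) (h1 n))
    refine (Finset.single_le_sum (f := fun j => (√(Y i j) - √(Z n i j)) ^ 2)
      (fun _ _ => sq_nonneg _) (Finset.mem_univ j)).trans ?_
    exact Finset.single_le_sum (f := fun i => ∑ j, (√(Y i j) - √(Z n i j)) ^ 2)
      (fun _ _ => Finset.sum_nonneg fun _ _ => sq_nonneg _) (Finset.mem_univ i)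
  have habs : Tendsto (fun n => |√(Y i j) - √(Z n i j)|) l (𝓝 0) := by
    simpa [Real.sqrt_sq_eq_abs] using hsq.sqrt
  have hsub := ((tendsto_zero_iff_abs_tendsto_zero _).2 habs).const_sub (√(Y i j))
  simpa [Real.sq_sqrt, hY i j, hZ] using hsub.pow 2

theorem sum_mul_row_add_col (Y : Matrix (Fin p) (Fin q) ℝ) (f : Fin p → ℝ) (g : Fin q → ℝ) :
    ∑ i, ∑ j, Y i j * (f i + g j) = ∑ i, (∑ j, Y i j) * f i + ∑ j, (∑ i, Y i j) * g j := by
  simp only [mul_add, Finset.sum_add_distrib, Finset.sum_mul]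
  rw [Finset.sum_comm (f := fun i j => Y i j * g j)]

/-- Scaling the reference matrix by rows and columns changes the relative entropy of `Y` by an
amount that depends only on the marginals of `Y`. -/
theorem relEnt_of_scaling {Y Z Z' : Matrix (Fin p) (Fin q) ℝ} {u : Fin p → ℝ} {v : Fin q → ℝ}
    (hu : ∀ i, 0 < u i) (hv : ∀ j, 0 < v j) (h : ∀ i j, Z' i j = u i * v j * Z i j)
    (h0 : ∀ i j, Z i j = 0 → Y i j = 0) :
    relEnt Y Z' = relEnt Y Z -
      (∑ i, (∑ j, Y i j) * Real.log (u i) + ∑ j, (∑ i, Y i j) * Real.log (v j)) := by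
  rw [← sum_mul_row_add_col, relEnt, relEnt, ← Finset.sum_sub_distrib]
  refine Finset.sum_congr rfl fun i _ => ?_
  rw [← Finset.sum_sub_distrib]
  refine Finset.sum_congr rfl fun j _ => ?_
  by_cases hy : Y i j = 0
  · simp [hy]
  have hz : Z i j ≠ 0 := fun hz => hy (h0 i j hz)
  rw [h, Real.log_div hy (mul_ne_zero (mul_pos (hu i) (hv j)).ne' hz), Real.log_div hy hz,
    Real.log_mul (mul_pos (hu i) (hv j)).ne' hz, Real.log_mul (hu i).ne' (hv j).ne']
  ring

/-- Summed form of `log x ≤ x - 1` for the weights `u i * v j`. -/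
theorem sum_log_le {Y : Matrix (Fin p) (Fin q) ℝ} {u : Fin p → ℝ} {v : Fin q → ℝ}
    (hY : ∀ i j, 0 ≤ Y i j) (hu : ∀ i, 0 < u i) (hv : ∀ j, 0 < v j) :
    ∑ i, (∑ j, Y i j) * Real.log (u i) + ∑ j, (∑ i, Y i j) * Real.log (v j) ≤
      ∑ i, ∑ j, u i * v j * Y i j - ∑ i, ∑ j, Y i j := by
  rw [← sum_mul_row_add_col, ← Finset.sum_sub_distrib]
  refine Finset.sum_le_sum fun i _ => ?_
  rw [← Finset.sum_sub_distrib]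
  refine Finset.sum_le_sum fun j _ => ?_
  rw [← Real.log_mul (hu i).ne' (hv j).ne']
  nlinarith [mul_le_mul_of_nonneg_left
    (Real.log_le_sub_one_of_pos (mul_pos (hu i) (hv j))) (hY i j)]

/-! ### Convergence of alternating scalings -/

theorem sum_sum_eq_one_of_row {X : Matrix (Fin p) (Fin q) ℝ} (ha1 : ∑ i, a i = 1)
    (h : ∀ i, ∑ j, X i j = a i) : ∑ i, ∑ j, X i j = 1 := by
  simp only [h, ha1]

theorem sum_sum_eq_one_of_col {X : Matrix (Fin p) (Fin q) ℝ} (hb1 : ∑ j, b j = 1)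
    (h : ∀ j, ∑ i, X i j = b j) : ∑ i, ∑ j, X i j = 1 :=
  Finset.sum_comm.trans (sum_sum_eq_one_of_row (X := X.transpose) hb1 h)

/-- The quantity `∑ a_i log R_i(X)`, which is minus the relative entropy of `scaleRows a X`
with respect to `X`. It increases along the iteration. -/
noncomputable def rowPotential (a : Fin p → ℝ) (X : Matrix (Fin p) (Fin q) ℝ) : ℝ :=
  ∑ i, a i * Real.log (rowRatio a X i)

/-- The relative entropy of `P = scaleRows a Q` with respect to `scaleCols b P` is at most that
of `P` with respect to `Q`. -/
theorem rowPotential_add_sum_le {Q : Matrix (Fin p) (Fin q) ℝ} (ha : ∀ i, 0 < a i)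
    (hb : ∀ j, 0 < b j) (hQ : Q ∈ Gamma0 p q)
    (hQb : ∀ j, ∑ i, Q i j = b j) :
    rowPotential a Q + ∑ j, (∑ i, scaleRows a Q i j) *
      Real.log (colRatio b (scaleRows a Q) j) ≤ 0 := by
  have hP := scaleRows_mem_Gamma0 ha hQ
  have h := sum_log_le hP.1 (rowRatio_pos ha hQ) (colRatio_pos hb hP)
  simp only [scaleRows_sum_row ha hQ] at h
  refine h.trans (le_of_eq (sub_eq_zero.2 ?_))
  calc ∑ i, ∑ j, rowRatio a Q i * colRatio b (scaleRows a Q) j * scaleRows a Q i j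
      = ∑ i, ∑ j, Q i j * colRatio b (scaleRows a Q) j := by
        refine Finset.sum_congr rfl fun i _ => Finset.sum_congr rfl fun j _ => ?_
        rw [mul_right_comm, rowRatio_mul_scaleRows ha hQ]
    _ = ∑ j, ∑ i, scaleRows a Q i j := by
        rw [Finset.sum_comm]
        refine Finset.sum_congr rfl fun j _ => ?_
        rw [← Finset.sum_mul, hQb, sum_col_eq hb, mul_comm]
    _ = ∑ i, a i := by
        rw [Finset.sum_comm]
        exact Finset.sum_congr rfl fun i _ => scaleRows_sum_row ha hQ i

/-- One full sweep does not decrease the row potential. -/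
theorem rowPotential_mono {Q : Matrix (Fin p) (Fin q) ℝ} (ha : ∀ i, 0 < a i)
    (hb : ∀ j, 0 < b j) (hQ : Q ∈ Gamma0 p q)
    (hQb : ∀ j, ∑ i, Q i j = b j) :
    rowPotential a Q ≤ rowPotential a (scaleCols b (scaleRows a Q)) := by
  have hP := scaleRows_mem_Gamma0 ha hQ
  have hQ' := scaleCols_mem_Gamma0 hb hP
  have h := sum_log_le hP.1 (fun i => inv_pos.2 (rowRatio_pos ha hQ' i))
    (fun j => inv_pos.2 (colRatio_pos hb hP j))
  have hmass : ∑ i, ∑ j, (rowRatio a (scaleCols b (scaleRows a Q)) i)⁻¹ *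
      (colRatio b (scaleRows a Q) j)⁻¹ * scaleRows a Q i j = ∑ i, a i :=
    Finset.sum_congr rfl fun i _ => by
      rw [← scaleRows_sum_row ha hQ' i]
      exact Finset.sum_congr rfl fun j _ => mul_assoc _ _ _
  simp only [scaleRows_sum_row ha hQ, Real.log_inv, mul_neg, Finset.sum_neg_distrib, hmass,
    sub_self] at h
  have h2 := rowPotential_add_sum_le ha hb hQ hQb
  simp only [rowPotential] at h2 ⊢
  linarith

/-- Consequence of the five-point inequality of Csiszár and Tusnády: if the row potential after a
full sweep does not exceed that of `L`, then the sweep does not increase the relative entropy of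
`scaleRows a L` with respect to the row-scaled matrix. -/
theorem relEnt_step_le {Q L : Matrix (Fin p) (Fin q) ℝ} (ha : ∀ i, 0 < a i)
    (hb : ∀ j, 0 < b j) (ha1 : ∑ i, a i = 1) (hQ : Q ∈ Gamma0 p q)
    (hL : L ∈ Gamma0 p q) (hLb : ∀ j, ∑ i, L i j = b j)
    (h0 : ∀ i j, Q i j = 0 → L i j = 0)
    (hr : rowPotential a (scaleCols b (scaleRows a Q)) ≤ rowPotential a L) :
    relEnt (scaleRows a L) (scaleRows a (scaleCols b (scaleRows a Q))) ≤
      relEnt (scaleRows a L) (scaleRows a Q) := by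
  have hP := scaleRows_mem_Gamma0 ha hQ
  have hQ' := scaleCols_mem_Gamma0 hb hP
  have hLP := scaleRows_mem_Gamma0 ha hL
  rw [relEnt_of_scaling (Y := scaleRows a L) (Z := scaleRows a Q)
    (Z' := scaleRows a (scaleCols b (scaleRows a Q)))
    (u := fun i => (rowRatio a (scaleCols b (scaleRows a Q)) i)⁻¹)
    (v := fun j => (colRatio b (scaleRows a Q) j)⁻¹)
    (fun i => inv_pos.2 (rowRatio_pos ha hQ' i)) (fun j => inv_pos.2 (colRatio_pos hb hP j))
    (fun i j => (mul_assoc _ _ _).symm) (fun i j hz => ?_)]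
  · -- the column part of the change is compared with its value at the limit
    have h1 := sum_log_le (u := fun _ => 1)
      (v := fun j => colRatio b (scaleRows a Q) j / colRatio b (scaleRows a L) j)
      hLP.1 (fun _ => one_pos)
      (fun j => div_pos (colRatio_pos hb hP j) (colRatio_pos hb hLP j))
    have hmass : ∑ i, ∑ j, 1 * (colRatio b (scaleRows a Q) j / colRatio b (scaleRows a L) j) *
        scaleRows a L i j = 1 := by
      refine Eq.trans ?_ (sum_sum_eq_one_of_row ha1 (scaleRows_sum_row ha hQ))
      rw [Finset.sum_comm, Finset.sum_comm (f := fun i j => scaleRows a Q i j)]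
      refine Finset.sum_congr rfl fun j _ => ?_
      have := (colRatio_pos hb hLP j).ne'
      rw [← Finset.mul_sum, sum_col_eq hb, sum_col_eq hb]
      field_simp
    have hlog : ∀ j, Real.log (colRatio b (scaleRows a Q) j / colRatio b (scaleRows a L) j) =
        Real.log (colRatio b (scaleRows a Q) j) - Real.log (colRatio b (scaleRows a L) j) :=
      fun j => Real.log_div (colRatio_pos hb hP j).ne' (colRatio_pos hb hLP j).ne'
    rw [hmass, sum_sum_eq_one_of_row ha1 (scaleRows_sum_row ha hL)] at h1
    simp only [hlog, mul_sub, Finset.sum_sub_distrib, Real.log_one, mul_zero,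
      Finset.sum_const_zero, sub_self, zero_add] at h1
    have h2 := rowPotential_add_sum_le ha hb hL hLb
    simp only [scaleRows_sum_row ha hL, Real.log_inv, mul_neg, Finset.sum_neg_distrib]
    simp only [rowPotential] at h2 hr
    linarith
  · rw [scaleRows_apply, h0 i j, mul_zero]
    exact (mul_eq_zero.1 hz).resolve_left (inv_ne_zero (rowRatio_pos ha hQ i).ne')

theorem exists_pos_forall_le (b : Fin q → ℝ) (hb : ∀ j, 0 < b j) : ∃ β, 0 < β ∧ ∀ j, β ≤ b j := by
  rcases isEmpty_or_nonempty (Fin q) with h | h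
  · exact ⟨1, one_pos, fun j => h.elim j⟩
  · obtain ⟨j, hj⟩ := Finite.exists_min b
    exact ⟨b j, hb j, hj⟩

/-- A limit point of the column-scaled matrices which itself lies in `Gamma0` exists, because
one sweep keeps the row sums away from `0`. -/
theorem exists_tendsto_subseq {Q : ℕ → Matrix (Fin p) (Fin q) ℝ} (ha : ∀ i, 0 < a i)
    (hb : ∀ j, 0 < b j) (ha1 : ∑ i, a i = 1) (hQ : ∀ n, Q n ∈ Gamma0 p q)
    (hQb : ∀ n j, ∑ i, Q n i j = b j)
    (hstep : ∀ n, Q (n + 1) = scaleCols b (scaleRows a (Q n))) :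
    ∃ L ∈ Gamma0 p q, (∀ j, ∑ i, L i j = b j) ∧ ∃ φ : ℕ → ℕ, StrictMono φ ∧
      ∀ i j, Tendsto (fun k => Q (φ k) i j) atTop (𝓝 (L i j)) := by
  have hK : IsCompact (Set.univ.pi fun _ : Fin p => Set.univ.pi fun j : Fin q =>
      Set.Icc (0 : ℝ) (b j)) :=
    isCompact_univ_pi fun _ => isCompact_univ_pi fun _ => isCompact_Icc
  have hmem : ∀ n, (fun i j => Q n i j) ∈ Set.univ.pi fun _ : Fin p =>
      Set.univ.pi fun j : Fin q => Set.Icc (0 : ℝ) (b j) := fun n i _ j _ =>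
    ⟨(hQ n).1 i j, by
      rw [← hQb n j]
      exact Finset.single_le_sum (f := fun i => Q n i j) (fun i _ => (hQ n).1 i j)
        (Finset.mem_univ i)⟩
  obtain ⟨L, -, φ, hφ, hlim⟩ := hK.tendsto_subseq hmem
  have hlim' : ∀ i j, Tendsto (fun k => Q (φ k) i j) atTop (𝓝 (L i j)) := fun i j =>
    tendsto_pi_nhds.1 (tendsto_pi_nhds.1 hlim i) j
  have hLb : ∀ j, ∑ i, L i j = b j := fun j =>
    tendsto_nhds_unique (tendsto_finsetSum _ fun i _ => hlim' i j)
      (by simp only [hQb]; exact tendsto_const_nhds)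
  obtain ⟨β, hβ, hβb⟩ := exists_pos_forall_le b hb
  have hrow : ∀ n, 1 ≤ n → ∀ i, β * a i ≤ ∑ j, Q n i j := by
    rintro n hn i
    obtain ⟨m, rfl⟩ := Nat.exists_eq_add_of_le' hn
    have hP := scaleRows_mem_Gamma0 ha (hQ m)
    rw [hstep, ← scaleRows_sum_row ha (hQ m) i, Finset.mul_sum]
    exact Finset.sum_le_sum fun j _ => (mul_le_mul_of_nonneg_right (hβb j) (hP.1 i j)).trans
      (mul_le_scaleCols hb hP (sum_sum_eq_one_of_row ha1 (scaleRows_sum_row ha (hQ m))) i j)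
  refine ⟨L, ⟨fun i j => ge_of_tendsto' (hlim' i j) fun k => (hQ _).1 i j, fun i => ?_,
    fun j => by rw [hLb]; exact hb j⟩, hLb, φ, hφ, hlim'⟩
  refine (mul_pos hβ (ha i)).trans_le (ge_of_tendsto (tendsto_finsetSum _ fun j _ => hlim' i j) ?_)
  filter_upwards [hφ.tendsto_atTop.eventually_ge_atTop 1] with k hk using hrow _ hk i

/-- The column-scaled matrices of the alternating scaling converge to a matrix in `Gamma0` which
is fixed by a full sweep. -/
theorem exists_tendsto_sweep {Q : ℕ → Matrix (Fin p) (Fin q) ℝ} (ha : ∀ i, 0 < a i)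
    (hb : ∀ j, 0 < b j) (ha1 : ∑ i, a i = 1) (hQ : ∀ n, Q n ∈ Gamma0 p q)
    (hQb : ∀ n j, ∑ i, Q n i j = b j)
    (hstep : ∀ n, Q (n + 1) = scaleCols b (scaleRows a (Q n))) :
    ∃ L ∈ Gamma0 p q, (∀ j, ∑ i, L i j = b j) ∧ scaleCols b (scaleRows a L) = L ∧
      ∀ i j, Tendsto (fun n => Q n i j) atTop (𝓝 (L i j)) := by
  obtain ⟨L, hL, hLb, φ, hφ, hlim⟩ := exists_tendsto_subseq ha hb ha1 hQ hQb hstep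
  have hLP := scaleRows_mem_Gamma0 ha hL
  -- positions vanishing at time `n` vanish ever after
  have hzero : ∀ n i j, Q n i j = 0 → L i j = 0 := by
    intro n i j h
    have hz : ∀ m, n ≤ m → Q m i j = 0 := fun m hm => by
      induction m, hm using Nat.le_induction with
      | base => exact h
      | succ m _ ih => rw [hstep, scaleCols_apply, scaleRows_apply, ih, mul_zero, mul_zero]
    refine tendsto_nhds_unique (hlim i j) (tendsto_const_nhds.congr' ?_)
    filter_upwards [hφ.tendsto_atTop.eventually_ge_atTop n] with k hk using (hz _ hk).symm
  have hmono : Monotone fun n => rowPotential a (Q n) := monotone_nat_of_le_succ fun n => by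
    rw [hstep]
    exact rowPotential_mono ha hb (hQ n) (hQb n)
  have hpot : ∀ n, rowPotential a (Q n) ≤ rowPotential a L := fun n => by
    refine ge_of_tendsto (f := fun k => rowPotential a (Q (φ k)))
      (tendsto_finsetSum _ fun i _ => ((tendsto_rowRatio hlim i).log
        (rowRatio_pos ha hL i).ne').const_mul (a i)) ?_
    filter_upwards [hφ.tendsto_atTop.eventually_ge_atTop n] with k hk using hmono hk
  have hanti : Antitone fun n => relEnt (scaleRows a L) (scaleRows a (Q n)) :=
    antitone_nat_of_succ_le fun n => by
      have := hpot (n + 1)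
      rw [hstep] at this ⊢
      exact relEnt_step_le ha hb ha1 (hQ n) hL hLb (hzero n) this
  have hP0 : ∀ n i j, scaleRows a (Q n) i j = 0 → scaleRows a L i j = 0 := fun n i j hz => by
    rw [scaleRows_apply, hzero n i j, mul_zero]
    exact (mul_eq_zero.1 hz).resolve_left (inv_ne_zero (rowRatio_pos ha (hQ n) i).ne')
  have hmass : ∀ n, ∑ i, ∑ j, scaleRows a L i j = ∑ i, ∑ j, scaleRows a (Q n) i j := fun n => by
    rw [sum_sum_eq_one_of_row ha1 (scaleRows_sum_row ha hL),
      sum_sum_eq_one_of_row ha1 (scaleRows_sum_row ha (hQ n))]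
  have hsub : Tendsto (fun k => relEnt (scaleRows a L) (scaleRows a (Q (φ k)))) atTop (𝓝 0) :=
    tendsto_relEnt_zero (tendsto_scaleRows ha hL hlim)
  have hent : Tendsto (fun n => relEnt (scaleRows a L) (scaleRows a (Q n))) atTop (𝓝 0) :=
    tendsto_iff_tendsto_subseq_of_antitone hanti hφ.tendsto_atTop |>.2 hsub
  have hP : ∀ i j, Tendsto (fun n => scaleRows a (Q n) i j) atTop (𝓝 (scaleRows a L i j)) :=
    tendsto_of_relEnt hLP.1 (fun n => (scaleRows_mem_Gamma0 ha (hQ n)).1) hP0 hmass hent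
  have hQlim : ∀ i j, Tendsto (fun n => Q n i j) atTop
      (𝓝 (scaleCols b (scaleRows a L) i j)) := fun i j => by
    rw [← tendsto_add_atTop_iff_nat 1]
    simp only [hstep]
    exact tendsto_scaleCols hb hLP hP i j
  have hfix : scaleCols b (scaleRows a L) = L := by
    ext i j
    exact tendsto_nhds_unique ((hQlim i j).comp hφ.tendsto_atTop) (hlim i j)
  exact ⟨L, hL, hLb, hfix, fun i j => by simpa only [hfix] using hQlim i j⟩

variable {X₀ : Matrix (Fin p) (Fin q) ℝ}

/-! ### Sequences with two alternating growth rates -/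

theorem tendsto_of_even_of_odd {α : Type*} {f : ℕ → α} {l : Filter α}
    (h0 : Tendsto (fun n => f (2 * n)) atTop l)
    (h1 : Tendsto (fun n => f (2 * n + 1)) atTop l) : Tendsto f atTop l := by
  intro s hs
  obtain ⟨N, hN⟩ := eventually_atTop.1 (h0 hs)
  obtain ⟨M, hM⟩ := eventually_atTop.1 (h1 hs)
  refine eventually_atTop.2 ⟨2 * N + 2 * M, fun n hn => ?_⟩
  obtain ⟨k, rfl | rfl⟩ := Nat.even_or_odd' n
  · exact hN k (by omega)
  · exact hM k (by omega)

/-- If the increments of `y` converge to `A` at even times and to `B` at odd times, then `y`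
grows linearly with the average slope `(A + B) / 2`. -/
theorem tendsto_div_of_alternating {y : ℕ → ℝ} {A B : ℝ}
    (hA : Tendsto (fun n => y (2 * n + 1) - y (2 * n)) atTop (𝓝 A))
    (hB : Tendsto (fun n => y (2 * n + 2) - y (2 * n + 1)) atTop (𝓝 B)) :
    Tendsto (fun n : ℕ => y n / n) atTop (𝓝 ((A + B) / 2)) := by
  -- the explicit sequence with increments exactly `A, B, A, B, …`
  set e : ℕ → ℝ := fun n => if Even n then 0 else (A - B) / 2 with he
  set t : ℕ → ℝ := fun n => n * ((A + B) / 2) + e n with ht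
  have heven : ∀ n, e (2 * n) = 0 := fun n => by simp [he]
  have hodd : ∀ n, e (2 * n + 1) = (A - B) / 2 := fun n => by simp [he]
  have hinc : Tendsto (fun n => (y (n + 1) - t (n + 1)) - (y n - t n)) atTop (𝓝 0) := by
    refine tendsto_of_even_of_odd ?_ ?_
    · have := hA.sub_const A
      rw [sub_self] at this
      refine this.congr fun n => ?_
      simp only [ht, heven, hodd]
      push_cast
      ring
    · have := hB.sub_const B
      rw [sub_self] at this
      refine this.congr fun n => ?_
      simp only [ht, hodd]
      rw [show 2 * n + 1 + 1 = 2 * (n + 1) by ring, heven]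
      push_cast
      ring
  have hces := hinc.cesaro
  simp only [Finset.sum_range_sub (fun n => y n - t n)] at hces
  have hinv := tendsto_inv_atTop_nhds_zero_nat (𝕜 := ℝ)
  have hbdd : Tendsto (fun n : ℕ => (n : ℝ)⁻¹ * e n) atTop (𝓝 0) := by
    refine hinv.zero_mul_isBoundedUnder_le (isBoundedUnder_of ⟨|(A - B) / 2|, fun n => ?_⟩)
    simp only [he, Function.comp]
    split_ifs
    · simp
    · exact (Real.norm_eq_abs _).le
  have hlim := ((hces.add (hinv.mul_const (y 0 - t 0))).add hbdd).add_const ((A + B) / 2)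
  simp only [zero_mul, zero_add] at hlim
  refine hlim.congr' ?_
  filter_upwards [eventually_gt_atTop 0] with n hn
  have hn' : (n : ℝ) ≠ 0 := by exact_mod_cast hn.ne'
  simp only [ht]
  field_simp
  ring

/-! ### I-projections -/

theorem iDiv_eq_relEnt {Y X : Matrix (Fin p) (Fin q) ℝ} (hY : ∀ i j, 0 ≤ Y i j)
    (h : supp Y ⊆ supp X) : iDiv Y X = (relEnt Y X : ℝ) := by
  classical
  rw [iDiv, if_pos h, relEnt, ← Fintype.sum_prod_type', Finset.sum_filter]
  congr 1
  refine Finset.sum_congr rfl fun x _ => ?_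
  split_ifs with hx
  · rfl
  · have h0 : Y x.1 x.2 = 0 := le_antisymm (not_lt.1 fun hlt => hx (h hlt)) (hY _ _)
    rw [h0, zero_mul]

/-- A limit `L` of row and column scalings of `X` is the I-projection of `X` on the set of
matrices with the marginals of `L`: for `Y` in this set, the gap `D(Y‖X) - D(L‖X)` is bounded
below by the squared Hellinger distance between `Y` and `L`. -/
theorem isIProjection_of_tendsto_scaling {X L : Matrix (Fin p) (Fin q) ℝ}
    {Z : ℕ → Matrix (Fin p) (Fin q) ℝ} {α : Fin p → ℝ} {β : Fin q → ℝ}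
    (hX : ∀ i j, 0 ≤ X i j) (hL : L ∈ Gamma α β X)
    (hZ : ∀ n, ∃ (u : Fin p → ℝ) (v : Fin q → ℝ), (∀ i, 0 < u i) ∧ (∀ j, 0 < v j) ∧
      ∀ i j, Z n i j = u i * v j * X i j)
    (hmass : ∀ n, ∑ i, ∑ j, Z n i j = ∑ i, α i)
    (hlim : ∀ i j, Tendsto (fun n => Z n i j) atTop (𝓝 (L i j))) :
    IsIProjection X (Gamma α β X) L := by
  have hXY : ∀ Y ∈ Gamma α β X, ∀ i j, X i j = 0 → Y i j = 0 := fun Y hY i j h0 =>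
    le_antisymm (not_lt.1 fun hlt => (hY.2.2.2 (show (i, j) ∈ supp Y from hlt)).ne' h0)
      (hY.1.1 i j)
  have hgap : ∀ Y ∈ Gamma α β X,
      ∑ i, ∑ j, (√(Y i j) - √(L i j)) ^ 2 ≤ relEnt Y X - relEnt L X := by
    intro Y hY
    have hl : Tendsto (fun n => ∑ i, ∑ j, (√(Y i j) - √(Z n i j)) ^ 2) atTop
        (𝓝 (∑ i, ∑ j, (√(Y i j) - √(L i j)) ^ 2)) :=
      tendsto_finsetSum _ fun i _ => tendsto_finsetSum _ fun j _ =>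
        ((hlim i j).sqrt.const_sub _).pow 2
    have hr := (tendsto_relEnt_zero hlim).const_add (relEnt Y X - relEnt L X)
    rw [add_zero] at hr
    refine le_of_tendsto_of_tendsto' hl hr fun n => ?_
    obtain ⟨u, v, hu, hv, huv⟩ := hZ n
    have h1 := relEnt_of_scaling hu hv huv (hXY Y hY)
    have h2 := relEnt_of_scaling hu hv huv (hXY L hL)
    simp only [hY.2.1, hY.2.2.1] at h1
    simp only [hL.2.1, hL.2.2.1] at h2
    have h3 := sum_sq_sqrt_sub_le_relEnt (Y := Y) (Z := Z n) hY.1.1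
      (fun i j => by
        rw [huv]
        exact mul_nonneg (mul_pos (hu i) (hv j)).le (hX i j))
      (fun i j h => hXY Y hY i j (by
        rw [huv] at h
        exact (mul_eq_zero.1 h).resolve_left (mul_pos (hu i) (hv j)).ne'))
      (by simp only [hY.2.1, hmass])
    linarith
  have hiff : ∀ Y ∈ Gamma α β X, iDiv Y X = (relEnt Y X : ℝ) := fun Y hY =>
    iDiv_eq_relEnt hY.1.1 hY.2.2.2
  refine ⟨hL, fun Y hY => ?_, fun L' hL' hmin => ?_⟩
  · rw [hiff L hL, hiff Y hY, EReal.coe_le_coe_iff, ← sub_nonneg]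
    exact le_trans (Finset.sum_nonneg fun i _ => Finset.sum_nonneg fun j _ => sq_nonneg _)
      (hgap Y hY)
  · have h1 := hmin L hL
    rw [hiff L hL, hiff L' hL', EReal.coe_le_coe_iff, ← sub_nonpos] at h1
    have h2 := (hgap L' hL').trans h1
    ext i j
    have h3 : (√(L' i j) - √(L i j)) ^ 2 ≤ 0 := by
      refine le_trans ?_ h2
      refine (Finset.single_le_sum (f := fun j => (√(L' i j) - √(L i j)) ^ 2)
        (fun _ _ => sq_nonneg _) (Finset.mem_univ j)).trans ?_
      exact Finset.single_le_sum (f := fun i => ∑ j, (√(L' i j) - √(L i j)) ^ 2)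
        (fun _ _ => Finset.sum_nonneg fun _ _ => sq_nonneg _) (Finset.mem_univ i)
    have h4 := sub_eq_zero.1 (pow_eq_zero_iff two_ne_zero |>.1 (le_antisymm h3 (sq_nonneg _)))
    exact (Real.sqrt_inj (hL'.1.1 i j) (hL.1.1 i j)).1 h4

/-! ### The iterative proportional fitting sequence -/

theorem ipfp_two_mul_add_one (a : Fin p → ℝ) (b : Fin q → ℝ) (X₀ : Matrix (Fin p) (Fin q) ℝ)
    (n : ℕ) : ipfp a b X₀ (2 * n + 1) = scaleRows a (ipfp a b X₀ (2 * n)) :=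
  if_pos (even_two_mul n)

theorem ipfp_two_mul_add_two (a : Fin p → ℝ) (b : Fin q → ℝ) (X₀ : Matrix (Fin p) (Fin q) ℝ)
    (n : ℕ) : ipfp a b X₀ (2 * n + 2) = scaleCols b (ipfp a b X₀ (2 * n + 1)) :=
  if_neg (by simp)

theorem ipfp_mem_Gamma0 (ha : ∀ i, 0 < a i) (hb : ∀ j, 0 < b j) (hX₀ : X₀ ∈ Gamma0 p q) (n : ℕ) :
    ipfp a b X₀ n ∈ Gamma0 p q := by
  induction n with
  | zero => exact hX₀
  | succ n ih =>
    rw [ipfp]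
    split_ifs
    · exact scaleRows_mem_Gamma0 ha ih
    · exact scaleCols_mem_Gamma0 hb ih

theorem exists_ipfp_eq_scaling (ha : ∀ i, 0 < a i) (hb : ∀ j, 0 < b j) (hX₀ : X₀ ∈ Gamma0 p q)
    (n : ℕ) : ∃ (u : Fin p → ℝ) (v : Fin q → ℝ), (∀ i, 0 < u i) ∧ (∀ j, 0 < v j) ∧
      ∀ i j, ipfp a b X₀ n i j = u i * v j * X₀ i j := by
  induction n with
  | zero => exact ⟨1, 1, fun _ => one_pos, fun _ => one_pos, fun i j => by simp [ipfp]⟩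
  | succ n ih =>
    obtain ⟨u, v, hu, hv, h⟩ := ih
    have hn := ipfp_mem_Gamma0 ha hb hX₀ n
    rw [ipfp]
    split_ifs
    · exact ⟨fun i => (rowRatio a (ipfp a b X₀ n) i)⁻¹ * u i, v,
        fun i => mul_pos (inv_pos.2 (rowRatio_pos ha hn i)) (hu i), hv,
        fun i j => by rw [scaleRows_apply, h]; ring⟩
    · exact ⟨u, fun j => (colRatio b (ipfp a b X₀ n) j)⁻¹ * v j, hu,
        fun j => mul_pos (inv_pos.2 (colRatio_pos hb hn j)) (hv j),
        fun i j => by rw [scaleCols_apply, h]; ring⟩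

theorem ipfp_eq_zero (ha : ∀ i, 0 < a i) (hb : ∀ j, 0 < b j) (hX₀ : X₀ ∈ Gamma0 p q)
    {i : Fin p} {j : Fin q} (h : X₀ i j = 0) (n : ℕ) : ipfp a b X₀ n i j = 0 := by
  obtain ⟨u, v, -, -, huv⟩ := exists_ipfp_eq_scaling ha hb hX₀ n
  rw [huv, h, mul_zero]

theorem ipfp_pos (ha : ∀ i, 0 < a i) (hb : ∀ j, 0 < b j) (hX₀ : X₀ ∈ Gamma0 p q)
    {i : Fin p} {j : Fin q} (h : 0 < X₀ i j) (n : ℕ) : 0 < ipfp a b X₀ n i j := by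
  obtain ⟨u, v, hu, hv, huv⟩ := exists_ipfp_eq_scaling ha hb hX₀ n
  rw [huv]
  exact mul_pos (mul_pos (hu i) (hv j)) h

/-- `L` is a limit of the even iterates: a matrix with column sums `b`, fixed by a full sweep.
The odd iterates then converge to `scaleRows a L`. -/
structure IsEvenLimit (a : Fin p → ℝ) (b : Fin q → ℝ) (X₀ L : Matrix (Fin p) (Fin q) ℝ) :
    Prop where
  mem : L ∈ Gamma0 p q
  sum_col : ∀ j, ∑ i, L i j = b j
  fixed : scaleCols b (scaleRows a L) = L
  even : ∀ i j, Tendsto (fun n => ipfp a b X₀ (2 * n) i j) atTop (𝓝 (L i j))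

theorem exists_isEvenLimit (ha : ∀ i, 0 < a i) (hb : ∀ j, 0 < b j) (ha1 : ∑ i, a i = 1)
    (hX₀ : X₀ ∈ Gamma0 p q) : ∃ L, IsEvenLimit a b X₀ L := by
  -- the column sums are `b` only from index `2` on
  obtain ⟨L, hL, hLb, hfix, hlim⟩ :=
    exists_tendsto_sweep (Q := fun n => ipfp a b X₀ (2 * (n + 1))) ha hb ha1
      (fun n => ipfp_mem_Gamma0 ha hb hX₀ _)
      (fun n j => by
        simp only [show 2 * (n + 1) = 2 * n + 2 by ring, ipfp_two_mul_add_two]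
        exact scaleCols_sum_col hb (ipfp_mem_Gamma0 ha hb hX₀ _) j)
      (fun n => by
        simp only [show 2 * (n + 1 + 1) = 2 * (n + 1) + 2 by ring, ipfp_two_mul_add_two,
          ipfp_two_mul_add_one])
  exact ⟨L, hL, hLb, hfix, fun i j =>
    (tendsto_add_atTop_iff_nat (f := fun n => ipfp a b X₀ (2 * n) i j) 1).1 (hlim i j)⟩

namespace IsEvenLimit

variable {L : Matrix (Fin p) (Fin q) ℝ}

theorem odd (h : IsEvenLimit a b X₀ L) (ha : ∀ i, 0 < a i) (i : Fin p) (j : Fin q) :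
    Tendsto (fun n => ipfp a b X₀ (2 * n + 1) i j) atTop (𝓝 (scaleRows a L i j)) := by
  simp only [ipfp_two_mul_add_one]
  exact tendsto_scaleRows ha h.mem h.even i j

theorem scaleRows_eq (h : IsEvenLimit a b X₀ L) (ha : ∀ i, 0 < a i) (hb : ∀ j, 0 < b j)
    (i : Fin p) (j : Fin q) :
    scaleRows a L i j = colRatio b (scaleRows a L) j * L i j := by
  nth_rewrite 3 [← h.fixed]
  exact (mul_inv_cancel_left₀
    (colRatio_pos hb (scaleRows_mem_Gamma0 ha h.mem) j).ne' _).symm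

theorem rowRatio_mul_colRatio (h : IsEvenLimit a b X₀ L) (ha : ∀ i, 0 < a i)
    (hb : ∀ j, 0 < b j) {i : Fin p} {j : Fin q} (hij : L i j ≠ 0) :
    rowRatio a L i * colRatio b (scaleRows a L) j = 1 := by
  have h1 := rowRatio_mul_scaleRows ha h.mem i j
  rw [h.scaleRows_eq ha hb, ← mul_assoc] at h1
  exact mul_right_cancel₀ hij (h1.trans (one_mul _).symm)

theorem eq_zero (h : IsEvenLimit a b X₀ L) (ha : ∀ i, 0 < a i) (hb : ∀ j, 0 < b j)
    (hX₀ : X₀ ∈ Gamma0 p q) {i : Fin p} {j : Fin q} (hij : X₀ i j = 0) : L i j = 0 :=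
  tendsto_nhds_unique (h.even i j)
    (by simp only [ipfp_eq_zero ha hb hX₀ hij]; exact tendsto_const_nhds)

/-- Every entry in the support of `X₀` has an exponential rate, given by the limits of the row
and column ratios. -/
theorem tendsto_log_div (h : IsEvenLimit a b X₀ L) (ha : ∀ i, 0 < a i) (hb : ∀ j, 0 < b j)
    (hX₀ : X₀ ∈ Gamma0 p q) {i : Fin p} {j : Fin q} (hij : 0 < X₀ i j) :
    Tendsto (fun n : ℕ => Real.log (ipfp a b X₀ n i j) / n) atTop
      (𝓝 (-Real.log (rowRatio a L i * colRatio b (scaleRows a L) j) / 2)) := by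
  have hR := rowRatio_pos ha h.mem i
  have hC := colRatio_pos hb (scaleRows_mem_Gamma0 ha h.mem) j
  rw [Real.log_mul hR.ne' hC.ne', neg_add]
  refine tendsto_div_of_alternating ?_ ?_
  · refine ((tendsto_rowRatio h.even i).log hR.ne').neg.congr fun n => ?_
    rw [ipfp_two_mul_add_one, scaleRows_apply, Real.log_mul
      (inv_ne_zero (rowRatio_pos ha (ipfp_mem_Gamma0 ha hb hX₀ _) i).ne')
      (ipfp_pos ha hb hX₀ hij _).ne', Real.log_inv]
    ring
  · refine ((tendsto_colRatio (h.odd ha) j).log hC.ne').neg.congr fun n => ?_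
    rw [ipfp_two_mul_add_two, scaleCols_apply, Real.log_mul
      (inv_ne_zero (colRatio_pos hb (ipfp_mem_Gamma0 ha hb hX₀ _) j).ne')
      (ipfp_pos ha hb hX₀ hij _).ne', Real.log_inv]
    ring

theorem tendsto_zero (h : IsEvenLimit a b X₀ L) (ha : ∀ i, 0 < a i) (hb : ∀ j, 0 < b j)
    {i : Fin p} {j : Fin q}
    (hne : rowRatio a L i * colRatio b (scaleRows a L) j ≠ 1) :
    Tendsto (fun n => ipfp a b X₀ n i j) atTop (𝓝 0) := by
  have h0 : L i j = 0 := not_not.1 fun hL => hne (h.rowRatio_mul_colRatio ha hb hL)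
  have h1 := h.even i j
  have h2 := h.odd ha i j
  rw [scaleRows_apply, h0, mul_zero] at h2
  rw [h0] at h1
  exact tendsto_of_even_of_odd h1 h2

/-- On the support of `X₀` the limiting growth factor over a full sweep is at most `1`, since
the iterates stay bounded. -/
theorem one_le_of_pos (h : IsEvenLimit a b X₀ L) (ha : ∀ i, 0 < a i) (hb : ∀ j, 0 < b j)
    (hX₀ : X₀ ∈ Gamma0 p q) {i : Fin p} {j : Fin q} (hij : 0 < X₀ i j) :
    1 ≤ rowRatio a L i * colRatio b (scaleRows a L) j := by
  by_contra! hlt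
  have hpos := mul_pos (rowRatio_pos ha h.mem i)
    (colRatio_pos hb (scaleRows_mem_Gamma0 ha h.mem) j)
  have hrate : 0 < -Real.log (rowRatio a L i * colRatio b (scaleRows a L) j) / 2 := by
    have := Real.log_neg hpos hlt
    linarith
  have h1 := (h.tendsto_log_div ha hb hX₀ hij).eventually (lt_mem_nhds hrate)
  have h2 := (h.tendsto_zero ha hb hlt.ne).eventually (gt_mem_nhds one_pos)
  obtain ⟨n, hn1, hn2⟩ := (h1.and h2).exists
  exact absurd (div_nonpos_of_nonpos_of_nonneg
    (Real.log_nonpos (ipfp_pos ha hb hX₀ hij n).le hn2.le) n.cast_nonneg) (not_le.2 hn1)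

theorem convergesGeometrically (h : IsEvenLimit a b X₀ L) (ha : ∀ i, 0 < a i)
    (hb : ∀ j, 0 < b j) (hX₀ : X₀ ∈ Gamma0 p q) {i : Fin p} {j : Fin q} (hij : 0 < X₀ i j)
    (hlt : 1 < rowRatio a L i * colRatio b (scaleRows a L) j) :
    ConvergesGeometrically (fun n => ipfp a b X₀ n i j) 0 := by
  refine ⟨h.tendsto_zero ha hb hlt.ne', _, Real.exp_pos _, ?_,
    ((Real.continuous_exp.tendsto _).comp (h.tendsto_log_div ha hb hX₀ hij)).congr fun n => ?_⟩
  · rw [Real.exp_lt_one_iff]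
    have := Real.log_pos hlt
    linarith
  · have hn := ipfp_pos ha hb hX₀ hij n
    rw [sub_zero, Real.norm_of_nonneg hn.le, Real.rpow_def_of_pos hn, mul_one_div]
    rfl

/-- A matrix supported in the support of `X₀` and having the marginals of some `T` with support in
the set where the product of limiting ratios is `1` has its support in this set too: the sum of
`S(i,j) log (R_i C_j)` depends only on the marginals, hence is `0`, and its terms are
nonnegative. -/
theorem eq_one_of_pos (h : IsEvenLimit a b X₀ L) (ha : ∀ i, 0 < a i) (hb : ∀ j, 0 < b j)
    (hX₀ : X₀ ∈ Gamma0 p q) {α : Fin p → ℝ} {β : Fin q → ℝ} {S T : Matrix (Fin p) (Fin q) ℝ}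
    (hS : S ∈ Gamma α β X₀) (hT : T ∈ Gamma α β X₀)
    (hT1 : ∀ i j, T i j ≠ 0 → rowRatio a L i * colRatio b (scaleRows a L) j = 1)
    {i : Fin p} {j : Fin q} (hij : 0 < S i j) :
    rowRatio a L i * colRatio b (scaleRows a L) j = 1 := by
  set ρ := rowRatio a L
  set γ := colRatio b (scaleRows a L)
  have hρ : ∀ i, 0 < ρ i := rowRatio_pos ha h.mem
  have hγ : ∀ j, 0 < γ j := colRatio_pos hb (scaleRows_mem_Gamma0 ha h.mem)
  have hlog : ∀ i j, Real.log (ρ i) + Real.log (γ j) = Real.log (ρ i * γ j) := fun i j =>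
    (Real.log_mul (hρ i).ne' (hγ j).ne').symm
  have hTsum : ∑ i, ∑ j, T i j * (Real.log (ρ i) + Real.log (γ j)) = 0 :=
    Finset.sum_eq_zero fun i _ => Finset.sum_eq_zero fun j _ => by
      by_cases hz : T i j = 0
      · rw [hz, zero_mul]
      · rw [hlog, hT1 i j hz, Real.log_one, mul_zero]
  have hSsum : ∑ i, ∑ j, S i j * (Real.log (ρ i) + Real.log (γ j)) = 0 := by
    rw [← hTsum, sum_mul_row_add_col, sum_mul_row_add_col]
    simp only [hS.2.1, hS.2.2.1, hT.2.1, hT.2.2.1]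
  have hnonneg : ∀ i j, 0 ≤ S i j * (Real.log (ρ i) + Real.log (γ j)) := fun i j => by
    rcases (hS.1.1 i j).eq_or_lt with hz | hz
    · rw [← hz, zero_mul]
    · rw [hlog]
      exact mul_nonneg hz.le (Real.log_nonneg
        (h.one_le_of_pos ha hb hX₀ (hS.2.2.2 (show (i, j) ∈ supp S from hz))))
  have h1 := (Finset.sum_eq_zero_iff_of_nonneg fun i _ =>
    Finset.sum_nonneg fun j _ => hnonneg i j).1 hSsum i (Finset.mem_univ i)
  have h2 := (Finset.sum_eq_zero_iff_of_nonneg fun j _ => hnonneg i j).1 h1 j (Finset.mem_univ j)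
  rw [hlog] at h2
  exact Real.eq_one_of_pos_of_log_eq_zero (mul_pos (hρ i) (hγ j))
    ((mul_eq_zero.1 h2).resolve_left hij.ne')

end IsEvenLimit

/-! ### The block structure -/

/-- The fibres of a function over the (distinct) values `lam k` form a partition. -/
theorem isPartition_fibers {α : Type*} [Fintype α] {r : ℕ} {f : α → ℝ} {lam : Fin r → ℝ}
    (hlam : Function.Injective lam) (h : Set.range f = Set.range lam) :
    IsPartition fun k => Finset.univ.filter fun x => f x = lam k := by
  refine ⟨fun k => ?_, fun k l hkl => ?_, fun x => ?_⟩
  · obtain ⟨x, hx⟩ := h.symm ▸ Set.mem_range_self (f := lam) k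
    exact ⟨x, by simpa using hx⟩
  · refine Finset.disjoint_filter.2 fun x _ hk hl => hkl (hlam (hk.symm.trans hl))
  · obtain ⟨k, hk⟩ := h ▸ Set.mem_range_self (f := f) x
    exact ⟨k, by simpa using hk.symm⟩

/-- A set of rows and a set of columns which meet the support of `M` in the same entries carry
the same mass. -/
theorem sum_row_eq_sum_col {M : Matrix (Fin p) (Fin q) ℝ} {I : Finset (Fin p)}
    {J : Finset (Fin q)} (h : ∀ i j, M i j ≠ 0 → (i ∈ I ↔ j ∈ J)) :
    ∑ i ∈ I, ∑ j, M i j = ∑ j ∈ J, ∑ i, M i j := by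
  have h1 : ∀ i ∈ I, ∑ j, M i j = ∑ j ∈ J, M i j := fun i hi =>
    (Finset.sum_subset (Finset.subset_univ J) fun j _ hj =>
      not_not.1 fun hM => hj ((h i j hM).1 hi)).symm
  have h2 : ∀ j ∈ J, ∑ i, M i j = ∑ i ∈ I, M i j := fun j hj =>
    (Finset.sum_subset (Finset.subset_univ I) fun i _ hi =>
      not_not.1 fun hM => hi ((h i j hM).2 hj)).symm
  rw [Finset.sum_congr rfl h1, Finset.sum_congr rfl h2, Finset.sum_comm]

/-- If the left scaling by `Diag(f)` and the right scaling by `Diag(g)` agree on `S`, the scaled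
matrix has the row sums of `S` multiplied by `f` and the column sums multiplied by `g`. -/
theorem diagonal_mul_mem_Gamma {S X : Matrix (Fin p) (Fin q) ℝ} {α f : Fin p → ℝ}
    {β g : Fin q → ℝ} (hS : S ∈ Gamma α β X) (hf : ∀ i, 0 < f i) (hg : ∀ j, 0 < g j)
    (h : ∀ i j, 0 < S i j → f i = g j) :
    Matrix.diagonal f * S = S * Matrix.diagonal g ∧
      Matrix.diagonal f * S ∈ Gamma (fun i => f i * α i) (fun j => g j * β j) X := by
  have hsw : ∀ i j, f i * S i j = g j * S i j := fun i j => by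
    rcases (hS.1.1 i j).eq_or_lt with h0 | h0
    · rw [← h0, mul_zero, mul_zero]
    · rw [h i j h0]
  have hrow : ∀ i, ∑ j, (Matrix.diagonal f * S) i j = f i * α i := fun i => by
    simp only [Matrix.diagonal_mul, ← Finset.mul_sum, hS.2.1]
  have hcol : ∀ j, ∑ i, (Matrix.diagonal f * S) i j = g j * β j := fun j => by
    simp only [Matrix.diagonal_mul, hsw, ← Finset.mul_sum, hS.2.2.1]
  refine ⟨?_, ⟨fun i j => ?_, fun i => ?_, fun j => ?_⟩, hrow, hcol, fun x hx => ?_⟩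
  · ext i j
    rw [Matrix.diagonal_mul, Matrix.mul_diagonal, hsw, mul_comm]
  · rw [Matrix.diagonal_mul]
    exact mul_nonneg (hf i).le (hS.1.1 i j)
  · rw [hrow, ← hS.2.1 i]
    exact mul_pos (hf i) (hS.1.2.1 i)
  · rw [hcol, ← hS.2.2.1 j]
    exact mul_pos (hg j) (hS.1.2.2 j)
  · have hx' : 0 < (Matrix.diagonal f * S) x.1 x.2 := hx
    rw [Matrix.diagonal_mul] at hx'
    exact hS.2.2.2 (show 0 < S x.1 x.2 from (mul_pos_iff_of_pos_left (hf x.1)).1 hx')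

end IPFP

/-! ### The limit of the iteration -/

theorem theorem4 (p q : ℕ) (a : Fin p → ℝ) (b : Fin q → ℝ)
    (ha : ∀ i, 0 < a i) (hb : ∀ j, 0 < b j)
    (ha1 : ∑ i, a i = 1) (hb1 : ∑ j, b j = 1)
    (X₀ : Matrix (Fin p) (Fin q) ℝ) (hX₀ : X₀ ∈ IPFP.Gamma0 p q) :
    ∃ (r : ℕ) (I : Fin r → Finset (Fin p)) (J : Fin r → Finset (Fin q))
      (lam : Fin r → ℝ) (a' : Fin p → ℝ) (b' : Fin q → ℝ),
      0 < r ∧ r ≤ min p q ∧ IPFP.IsPartition I ∧ IPFP.IsPartition J ∧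
      -- the numbers `λ_k` and the modified marginals `a'`, `b'`
      (∀ k, lam k = (∑ j ∈ J k, b j) / (∑ i ∈ I k, a i)) ∧
      (∀ k, ∀ i ∈ I k, a' i / a i = lam k) ∧
      (∀ k, ∀ j ∈ J k, b' j / b j = (lam k)⁻¹) ∧
      -- 1. limits of the normalised row sums
      (∀ k, ∀ i ∈ I k,
        Tendsto (fun n => IPFP.rowRatio a (IPFP.ipfp a b X₀ (2 * n)) i) atTop (𝓝 (lam k))) ∧
      -- 2. limits of the normalised column sums
      (∀ k, ∀ j ∈ J k,
        Tendsto (fun n => IPFP.colRatio b (IPFP.ipfp a b X₀ (2 * n + 1)) j) atTop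
          (𝓝 (lam k)⁻¹)) ∧
      -- 3. null blocks
      (∀ k k', k < k' → ∀ i ∈ I k, ∀ j ∈ J k', ∀ n, IPFP.ipfp a b X₀ n i j = 0) ∧
      -- 4. blocks whose entries tend to 0 at a geometric rate (or are identically null)
      (∀ k k', k' < k → ∀ i ∈ I k, ∀ j ∈ J k',
        (0 < X₀ i j → IPFP.ConvergesGeometrically (fun n => IPFP.ipfp a b X₀ n i j) 0) ∧
        (X₀ i j = 0 → ∀ n, IPFP.ipfp a b X₀ n i j = 0)) ∧
      -- 5. limit of the even subsequence
      (∃ L, Tendsto (fun n => IPFP.ipfp a b X₀ (2 * n)) atTop (𝓝 L) ∧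
        IPFP.IsIProjection X₀ (IPFP.Gamma a' b X₀) L) ∧
      -- 6. limit of the odd subsequence
      (∃ L, Tendsto (fun n => IPFP.ipfp a b X₀ (2 * n + 1)) atTop (𝓝 L) ∧
        IPFP.IsIProjection X₀ (IPFP.Gamma a b' X₀) L) ∧
      -- 7. block masses and block-diagonal supports
      (∀ k, ∑ i ∈ I k, a' i = ∑ j ∈ J k, b j ∧ ∑ i ∈ I k, a i = ∑ j ∈ J k, b' j) ∧
      (∀ S ∈ IPFP.Gamma a' b X₀ ∪ IPFP.Gamma a b' X₀, ∀ x ∈ IPFP.supp S,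
        ∃ k, x.1 ∈ I k ∧ x.2 ∈ J k) ∧
      -- 8. correspondence between the two sets of matrices
      (∀ S ∈ IPFP.Gamma a b' X₀,
        Matrix.diagonal (fun i => a' i / a i) * S = S * Matrix.diagonal (fun j => b j / b' j) ∧
        Matrix.diagonal (fun i => a' i / a i) * S ∈ IPFP.Gamma a' b X₀) ∧
      (∀ T ∈ IPFP.Gamma a' b X₀, ∃ S ∈ IPFP.Gamma a b' X₀,
        T = Matrix.diagonal (fun i => a' i / a i) * S) := by
  classical
  obtain ⟨L, hL⟩ := IPFP.exists_isEvenLimit ha hb ha1 hX₀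
  have hP := IPFP.scaleRows_mem_Gamma0 ha hL.mem
  have hPa : ∀ i, ∑ j, IPFP.scaleRows a L i j = a i := IPFP.scaleRows_sum_row ha hL.mem
  have hρ := IPFP.rowRatio_pos ha hL.mem
  have hγ := IPFP.colRatio_pos hb hP
  have hLa : ∀ i, ∑ j, L i j = IPFP.rowRatio a L i * a i := IPFP.sum_row_eq ha L
  have hPb : ∀ j, ∑ i, IPFP.scaleRows a L i j =
    IPFP.colRatio b (IPFP.scaleRows a L) j * b j := IPFP.sum_col_eq hb _
  have hL1 : ∀ i j, L i j ≠ 0 →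
    IPFP.rowRatio a L i * IPFP.colRatio b (IPFP.scaleRows a L) j = 1 :=
    fun i j => hL.rowRatio_mul_colRatio ha hb
  have hPL : ∀ i j, IPFP.scaleRows a L i j ≠ 0 → L i j ≠ 0 := fun i j =>
    right_ne_zero_of_mul
  have hLsupp : ∀ i j, 0 < L i j → 0 < X₀ i j := fun i j hij =>
    (hX₀.1 i j).lt_of_ne fun h => hij.ne' (hL.eq_zero ha hb hX₀ h.symm)
  have hLmem : L ∈ IPFP.Gamma (fun i => IPFP.rowRatio a L i * a i) b X₀ :=
    ⟨hL.mem, hLa, hL.sum_col, fun x hx => hLsupp _ _ hx⟩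
  have hPmem : IPFP.scaleRows a L ∈
      IPFP.Gamma a (fun j => IPFP.colRatio b (IPFP.scaleRows a L) j * b j) X₀ :=
    ⟨hP, hPa, hPb, fun x hx => hLsupp _ _
      ((hL.mem.1 _ _).lt_of_ne (hPL _ _ (ne_of_gt hx)).symm)⟩
  have hS1 : ∀ S ∈ IPFP.Gamma (fun i => IPFP.rowRatio a L i * a i) b X₀, ∀ i j, 0 < S i j →
      IPFP.rowRatio a L i * IPFP.colRatio b (IPFP.scaleRows a L) j = 1 :=
    fun S hS i j => hL.eq_one_of_pos ha hb hX₀ hS hLmem hL1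
  have hS2 : ∀ S ∈ IPFP.Gamma a (fun j => IPFP.colRatio b (IPFP.scaleRows a L) j * b j) X₀,
      ∀ i j, 0 < S i j →
      IPFP.rowRatio a L i * IPFP.colRatio b (IPFP.scaleRows a L) j = 1 :=
    fun S hS i j => hL.eq_one_of_pos ha hb hX₀ hS hPmem fun i j h => hL1 i j (hPL i j h)
  have hXge : ∀ i j, 0 < X₀ i j →
      1 ≤ IPFP.rowRatio a L i * IPFP.colRatio b (IPFP.scaleRows a L) j :=
    fun i j => hL.one_le_of_pos ha hb hX₀
  have hgeom : ∀ i j, 0 < X₀ i j →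
      1 < IPFP.rowRatio a L i * IPFP.colRatio b (IPFP.scaleRows a L) j →
      IPFP.ConvergesGeometrically (fun n => IPFP.ipfp a b X₀ n i j) 0 :=
    fun i j => hL.convergesGeometrically ha hb hX₀
  have hRlim := IPFP.tendsto_rowRatio (a := a) hL.even
  have hClim := IPFP.tendsto_colRatio (b := b) (hL.odd ha)
  have hscale : ∀ i j, (IPFP.rowRatio a L i) * IPFP.scaleRows a L i j = L i j :=
    IPFP.rowRatio_mul_scaleRows ha hL.mem
  -- the even iterates have mass `1` from index `2` on, the odd ones from index `1` on
  have hproj1 : IPFP.IsIProjection X₀ (IPFP.Gamma (fun i => IPFP.rowRatio a L i * a i) b X₀) L :=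
    IPFP.isIProjection_of_tendsto_scaling (Z := fun n => IPFP.ipfp a b X₀ (2 * (n + 1))) hX₀.1
      hLmem (fun n => IPFP.exists_ipfp_eq_scaling ha hb hX₀ _)
      (fun n => by
        rw [show 2 * (n + 1) = 2 * n + 2 by ring, IPFP.ipfp_two_mul_add_two,
          IPFP.sum_sum_eq_one_of_col hb1 (IPFP.scaleCols_sum_col hb
            (IPFP.ipfp_mem_Gamma0 ha hb hX₀ _)),
          ← IPFP.sum_sum_eq_one_of_col hb1 hL.sum_col]
        exact Finset.sum_congr rfl fun i _ => hLa i)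
      (fun i j => (hL.even i j).comp (tendsto_add_atTop_nat 1))
  have hproj2 : IPFP.IsIProjection X₀
      (IPFP.Gamma a (fun j => IPFP.colRatio b (IPFP.scaleRows a L) j * b j) X₀)
      (IPFP.scaleRows a L) :=
    IPFP.isIProjection_of_tendsto_scaling (Z := fun n => IPFP.ipfp a b X₀ (2 * n + 1)) hX₀.1
      hPmem (fun n => IPFP.exists_ipfp_eq_scaling ha hb hX₀ _)
      (fun n => by
        rw [IPFP.ipfp_two_mul_add_one]
        exact Finset.sum_congr rfl fun i _ =>
          IPFP.scaleRows_sum_row ha (IPFP.ipfp_mem_Gamma0 ha hb hX₀ _) i)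
      (hL.odd ha)
  have hoddlim := hL.odd ha
  set ρ := IPFP.rowRatio a L
  set P := IPFP.scaleRows a L
  set γ := IPFP.colRatio b P
  have hone : ∀ i j, ρ i * γ j = 1 ↔ ρ i = (γ j)⁻¹ := fun i j =>
    ⟨eq_inv_of_mul_eq_one_left, fun h => by rw [h, inv_mul_cancel₀ (hγ j).ne']⟩
  -- the two sets of limiting values coincide, since every row and column of `L` has an entry
  have hrange : Set.range ρ = Set.range fun j => (γ j)⁻¹ := by
    ext x
    constructor
    · rintro ⟨i, rfl⟩
      obtain ⟨j, -, hj⟩ := Finset.exists_ne_zero_of_sum_ne_zero (hL.mem.2.1 i).ne'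
      exact ⟨j, ((hone i j).1 (hL1 i j hj)).symm⟩
    · rintro ⟨j, rfl⟩
      obtain ⟨i, -, hi⟩ := Finset.exists_ne_zero_of_sum_ne_zero (hL.mem.2.2 j).ne'
      exact ⟨i, (hone i j).1 (hL1 i j hi)⟩
  let V : Finset ℝ := Finset.univ.image ρ
  have hV : V = Finset.univ.image fun j => (γ j)⁻¹ := by
    apply Finset.coe_injective
    simpa [V] using hrange
  let lam : Fin V.card → ℝ := V.orderEmbOfFin rfl
  have hlam : StrictMono lam := (V.orderEmbOfFin rfl).strictMono
  have hlamrange : Set.range ρ = Set.range lam := by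
    rw [Finset.range_orderEmbOfFin V rfl]
    simp [V]
  have hlampos : ∀ k, 0 < lam k := fun k => by
    obtain ⟨i, hi⟩ := hlamrange.symm ▸ Set.mem_range_self (f := lam) k
    exact hi ▸ hρ i
  let I : Fin V.card → Finset (Fin p) := fun k => Finset.univ.filter fun i => ρ i = lam k
  let J : Fin V.card → Finset (Fin q) := fun k => Finset.univ.filter fun j => (γ j)⁻¹ = lam k
  have hI : ∀ k i, i ∈ I k ↔ ρ i = lam k := fun k i => by simp [I]
  have hJ : ∀ k j, j ∈ J k ↔ (γ j)⁻¹ = lam k := fun k j => by simp [J]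
  have hpartI : IPFP.IsPartition I := IPFP.isPartition_fibers hlam.injective hlamrange
  have hpartJ : IPFP.IsPartition J :=
    IPFP.isPartition_fibers hlam.injective (hrange.symm.trans hlamrange)
  have hblock : ∀ k i j, L i j ≠ 0 → (i ∈ I k ↔ j ∈ J k) := fun k i j h => by
    rw [hI, hJ, (hone i j).1 (hL1 i j h)]
  have hprod : ∀ k k', ∀ i ∈ I k, ∀ j ∈ J k', ρ i * γ j = lam k / lam k' :=
    fun k k' i hi j hj => by
      rw [← (hI k i).1 hi, ← (hJ k' j).1 hj, div_inv_eq_mul]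
  have hmass1 : ∀ k, ∑ i ∈ I k, ρ i * a i = ∑ j ∈ J k, b j := fun k => by
    simpa only [hLa, hL.sum_col] using IPFP.sum_row_eq_sum_col (hblock k)
  have hmass2 : ∀ k, ∑ i ∈ I k, a i = ∑ j ∈ J k, γ j * b j := fun k => by
    simpa only [hPa, hPb] using
      IPFP.sum_row_eq_sum_col (M := P) fun i j h => hblock k i j (hPL i j h)
  have hcover : ∀ i j, ρ i * γ j = 1 → ∃ k, i ∈ I k ∧ j ∈ J k := fun i j h => by
    obtain ⟨k, hk⟩ := hpartI.2.2 i
    exact ⟨k, hk, (hJ k j).2 (((hone i j).1 h).symm.trans ((hI k i).1 hk))⟩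
  have hadiv : ∀ i, ρ i * a i / a i = ρ i := fun i => mul_div_cancel_right₀ _ (ha i).ne'
  have hbdiv : ∀ j, γ j * b j / b j = γ j := fun j => mul_div_cancel_right₀ _ (hb j).ne'
  have hbdiv' : ∀ j, b j / (γ j * b j) = (γ j)⁻¹ := fun j => by
    rw [← inv_div, hbdiv]
  refine ⟨V.card, I, J, lam, fun i => ρ i * a i, fun j => γ j * b j, ?_, ?_, hpartI, hpartJ,
    fun k => ?_, fun k i hi => ?_, fun k j hj => ?_, fun k i hi => ?_, fun k j hj => ?_,
    fun k k' hk i hi j hj n => ?_, fun k k' hk i hi j hj => ⟨fun hij => ?_, fun h n => ?_⟩,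
    ⟨L, ?_, hproj1⟩, ⟨P, ?_, hproj2⟩, fun k => ⟨hmass1 k, hmass2 k⟩, ?_, fun S hS => ?_,
    fun T hT => ?_⟩
  · have : Nonempty (Fin p) := by
      by_contra h
      rw [not_nonempty_iff] at h
      simp at ha1
    exact Finset.card_pos.2 (Finset.univ_nonempty.image ρ)
  · refine le_min (Finset.card_image_le.trans (Finset.card_fin p).le) ?_
    rw [hV]
    exact Finset.card_image_le.trans (Finset.card_fin q).le
  · rw [eq_div_iff (Finset.sum_pos (fun i _ => ha i) (hpartI.1 k)).ne', ← hmass1 k,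
      Finset.mul_sum]
    exact Finset.sum_congr rfl fun i hi => by rw [(hI k i).1 hi]
  · rw [hadiv, (hI k i).1 hi]
  · rw [hbdiv, ← (hJ k j).1 hj, inv_inv]
  · exact (hI k i).1 hi ▸ hRlim i
  · rw [← (hJ k j).1 hj, inv_inv]
    exact hClim j
  · refine IPFP.ipfp_eq_zero ha hb hX₀ ((hX₀.1 i j).eq_of_not_lt' fun hij => ?_) n
    have h1 := hXge i j hij
    rw [hprod k k' i hi j hj, one_le_div (hlampos k')] at h1
    exact absurd (hlam hk) (not_lt.2 h1)
  · refine hgeom i j hij ?_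
    rw [hprod k k' i hi j hj, one_lt_div (hlampos k')]
    exact hlam hk
  · exact IPFP.ipfp_eq_zero ha hb hX₀ h n
  · exact tendsto_pi_nhds.2 fun i => tendsto_pi_nhds.2 fun j => hL.even i j
  · exact tendsto_pi_nhds.2 fun i => tendsto_pi_nhds.2 fun j => hoddlim i j
  · rintro S (hS | hS) x hx
    · exact hcover _ _ (hS1 S hS _ _ hx)
    · exact hcover _ _ (hS2 S hS _ _ hx)
  · simp only [hadiv, hbdiv']
    obtain ⟨h1, h2⟩ := IPFP.diagonal_mul_mem_Gamma hS hρ (fun j => inv_pos.2 (hγ j))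
      fun i j h => (hone i j).1 (hS2 S hS i j h)
    refine ⟨h1, ?_⟩
    simpa only [inv_mul_cancel_left₀ (hγ _).ne'] using h2
  · simp only [hadiv]
    obtain ⟨-, h2⟩ := IPFP.diagonal_mul_mem_Gamma hT (fun i => inv_pos.2 (hρ i)) hγ
      fun i j h => by rw [(hone i j).1 (hS1 T hT i j h), inv_inv]
    refine ⟨Matrix.diagonal (fun i => (ρ i)⁻¹) * T, ?_, ?_⟩
    · simpa only [inv_mul_cancel_left₀ (hρ _).ne'] using h2
    · ext i j
      rw [Matrix.diagonal_mul, Matrix.diagonal_mul, mul_inv_cancel_left₀ (hρ i).ne']
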